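/- Let $E$ and $F$ be real Banach lattices, and let $E^*$, $F^*$ be their norm duals with the canonical lattice order. A sequence $(x_n)$ is \emph{disjoint} if $|x_n|\wedge|x_m|=0$ whenever $n\neq m$. A norm bounded subset $A$ of a Banach lattice $G$ is \emph{almost limited} if every disjoint weak* null sequence in $G^*$ converges uniformly to zero on $A$. A bounded linear operator $T:E\to F$ is \emph{weak almost limited} if $T(W)$ is almost limited for every relatively weakly compact $W\subset E$, and \emph{order bounded} if it maps order intervals into order intervals. $F$ has \emph{property (d)} if $|f_n|\to 0$ weak* for every disjoint weak* null sequence $(f_n)$ in $F^*$. Suppose that the lattice operations of $E^*$ are sequentially weak* continuous or that $F$ has property (d). Then for every order bounded (bounded linear) operator $T:E\to F$ the following assertions are equivalent: \begin{enumerate} \item[(1)] $T$ is weak almost limited. \item[(2)] $f_n(Tx_n)\to 0$ for every weakly null sequence $(x_n)\subset E^+$ and every disjoint weak* null sequence $(f_n)\subset F^*$. \item[(3)] $f_n(Tx_n)\to 0$ for every disjoint weakly null sequence $(x_n)\subset E$ and every disjoint weak* null sequence $(f_n)\subset F^*$. \item[(4)] $f_n(Tx_n)\to 0$ for every disjoint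 weakly null sequence $(x_n)\subset E^+$ and every disjoint weak* null sequence $(f_n)\subset F^*$. \item[(5)] $T$ maps the solid hull of each relatively weakly compact subset of $E$ to an almost limited subset of $F$. \end{enumerate} If $F$ has property (d), these are also equivalent to each of the following: \begin{enumerate} \item[(6)] $f_n(Tx_n)\to 0$ for every weakly null sequence $(x_n)\subset E^+$ and every disjoint weak* null sequence $(f_n)\subset (F^*)^+$. \item[(7)] $f_n(Tx_n)\to 0$ for every disjoint weakly null sequence $(x_n)\subset E^+$ and every disjoint weak* null sequence $(f_n)\subset (F^*)^+$. \end{enumerate} -/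

import Mathlib

open Filter Topology Set

/-! ### The dual of a Banach lattice as a vector lattice -/

section DualLattice

set_option linter.unusedSectionVars false

variable {E : Type*} [NormedAddCommGroup E] [NormedSpace ℝ E] [Lattice E] [HasSolidNorm E]
  [IsOrderedAddMonoid E]

/-- The canonical order of the dual: `f ≤ g` iff `f x ≤ g x` for all `x ≥ 0`. -/
instance BanachLattice.dualPartialOrder : PartialOrder (StrongDual ℝ E) where
  le f g := ∀ x : E, 0 ≤ x → f x ≤ g x
  le_refl _ _ _ := le_rfl
  le_trans _ _ _ hfg hgh x hx := (hfg x hx).trans (hgh x hx)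
  le_antisymm f g hfg hgf := by
    have key : ∀ x : E, 0 ≤ x → f x = g x := fun x hx => le_antisymm (hfg x hx) (hgf x hx)
    ext x
    rw [← posPart_sub_negPart x, map_sub, map_sub, key _ (posPart_nonneg x),
      key _ (negPart_nonneg x)]

instance BanachLattice.dualIsOrderedAddMonoid : IsOrderedAddMonoid (StrongDual ℝ E) where
  add_le_add_left f g hfg h x hx := by
    simpa using hfg x hx

/-- `f⁺(x) = sup {f y : 0 ≤ y ≤ x}`, the Riesz–Kantorovich formula (meant for `x ≥ 0`). -/
noncomputable def BanachLattice.rk (f : StrongDual ℝ E) (x : E) : ℝ := sSup (f '' Icc 0 x)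

theorem BanachLattice.rk_mem_le (f : StrongDual ℝ E) {x y : E} (hy : y ∈ Icc 0 x) :
    f y ≤ ‖f‖ * ‖x‖ := by
  have h1 : ‖y‖ ≤ ‖x‖ := norm_le_norm_of_abs_le_abs (by
    rw [abs_of_nonneg hy.1, abs_of_nonneg (hy.1.trans hy.2)]; exact hy.2)
  calc f y ≤ ‖f y‖ := Real.le_norm_self _
    _ ≤ ‖f‖ * ‖y‖ := f.le_opNorm y
    _ ≤ ‖f‖ * ‖x‖ := by gcongr

theorem BanachLattice.rk_bddAbove (f : StrongDual ℝ E) (x : E) : BddAbove (f '' Icc 0 x) := by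
  refine ⟨‖f‖ * ‖x‖, ?_⟩
  rintro _ ⟨y, hy, rfl⟩
  exact BanachLattice.rk_mem_le f hy

theorem BanachLattice.le_rk (f : StrongDual ℝ E) {x y : E} (hy0 : 0 ≤ y) (hyx : y ≤ x) :
    f y ≤ BanachLattice.rk f x :=
  le_csSup (BanachLattice.rk_bddAbove f x) ⟨y, ⟨hy0, hyx⟩, rfl⟩

theorem BanachLattice.rk_le (f : StrongDual ℝ E) {x : E} (hx : 0 ≤ x) {c : ℝ}
    (h : ∀ y, 0 ≤ y → y ≤ x → f y ≤ c) : BanachLattice.rk f x ≤ c := by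
  refine csSup_le ⟨f 0, 0, ⟨le_rfl, hx⟩, rfl⟩ ?_
  rintro _ ⟨y, hy, rfl⟩
  exact h y hy.1 hy.2

theorem BanachLattice.rk_nonneg (f : StrongDual ℝ E) {x : E} (hx : 0 ≤ x) :
    0 ≤ BanachLattice.rk f x := by
  simpa using BanachLattice.le_rk f le_rfl hx

theorem BanachLattice.rk_add (f : StrongDual ℝ E) {x y : E} (hx : 0 ≤ x) (hy : 0 ≤ y) :
    BanachLattice.rk f (x + y) = BanachLattice.rk f x + BanachLattice.rk f y := by
  apply le_antisymm
  · refine BanachLattice.rk_le f (add_nonneg hx hy) fun z hz0 hz => ?_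
    have h1 : f (z ⊓ x) ≤ BanachLattice.rk f x :=
      BanachLattice.le_rk f (le_inf hz0 hx) inf_le_right
    have h2 : f (z - z ⊓ x) ≤ BanachLattice.rk f y := by
      refine BanachLattice.le_rk f (sub_nonneg.2 inf_le_left) ?_
      rw [sub_le_comm]
      exact le_inf (sub_le_self z hy) (sub_le_iff_le_add.2 hz)
    rw [map_sub] at h2
    linarith
  · have h : BanachLattice.rk f x ≤ BanachLattice.rk f (x + y) - BanachLattice.rk f y := by
      refine BanachLattice.rk_le f hx fun u hu0 hu => ?_
      have : BanachLattice.rk f y ≤ BanachLattice.rk f (x + y) - f u := by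
        refine BanachLattice.rk_le f hy fun v hv0 hv => ?_
        have := BanachLattice.le_rk f (add_nonneg hu0 hv0) (add_le_add hu hv)
        rw [map_add] at this
        linarith
      linarith
    linarith

/-- The positive part of a functional: the additive extension to `E` of `BanachLattice.rk f`. -/
noncomputable def BanachLattice.dualPosAddHom (f : StrongDual ℝ E) : E →+ ℝ :=
  AddMonoidHom.mk' (fun x => BanachLattice.rk f x⁺ - BanachLattice.rk f x⁻) (by
    intro x y
    have e : (x + y)⁺ + (x⁻ + y⁻) = (x + y)⁻ + (x⁺ + y⁺) := by
      have h1 := posPart_sub_negPart (x + y)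
      have h2 := posPart_sub_negPart x
      have h3 := posPart_sub_negPart y
      rw [← sub_eq_zero]
      calc (x + y)⁺ + (x⁻ + y⁻) - ((x + y)⁻ + (x⁺ + y⁺))
          = ((x + y)⁺ - (x + y)⁻) - (x⁺ - x⁻) - (y⁺ - y⁻) := by abel
        _ = 0 := by rw [h1, h2, h3]; abel
    have e' := congrArg (BanachLattice.rk f) e
    rw [BanachLattice.rk_add f (posPart_nonneg _) (add_nonneg (negPart_nonneg _) (negPart_nonneg _)),
      BanachLattice.rk_add f (negPart_nonneg _) (add_nonneg (posPart_nonneg _) (posPart_nonneg _)),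
      BanachLattice.rk_add f (negPart_nonneg _) (negPart_nonneg _),
      BanachLattice.rk_add f (posPart_nonneg _) (posPart_nonneg _)] at e'
    linarith)

theorem BanachLattice.dualPosAddHom_bound (f : StrongDual ℝ E) (x : E) :
    ‖BanachLattice.dualPosAddHom f x‖ ≤ ‖f‖ * ‖x‖ := by
  have hp : ‖x⁺‖ ≤ ‖x‖ := norm_le_norm_of_abs_le_abs (by
    rw [abs_of_nonneg (posPart_nonneg x), ← posPart_add_negPart]
    exact le_add_of_nonneg_right (negPart_nonneg x))
  have hn : ‖x⁻‖ ≤ ‖x‖ := norm_le_norm_of_abs_le_abs (by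
    rw [abs_of_nonneg (negPart_nonneg x), ← posPart_add_negPart]
    exact le_add_of_nonneg_left (posPart_nonneg x))
  have h1 : BanachLattice.rk f x⁺ ≤ ‖f‖ * ‖x‖ :=
    BanachLattice.rk_le f (posPart_nonneg x) fun y h0 h =>
      (BanachLattice.rk_mem_le f ⟨h0, h⟩).trans (by gcongr)
  have h2 : BanachLattice.rk f x⁻ ≤ ‖f‖ * ‖x‖ :=
    BanachLattice.rk_le f (negPart_nonneg x) fun y h0 h =>
      (BanachLattice.rk_mem_le f ⟨h0, h⟩).trans (by gcongr)
  have h3 := BanachLattice.rk_nonneg f (posPart_nonneg x)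
  have h4 := BanachLattice.rk_nonneg f (negPart_nonneg x)
  change |BanachLattice.rk f x⁺ - BanachLattice.rk f x⁻| ≤ _
  rw [abs_le]
  constructor <;> linarith

/-- The positive part `f⁺` of a functional; real-linearity is automatic for continuous additive
maps. -/
noncomputable def BanachLattice.dualPos (f : StrongDual ℝ E) : StrongDual ℝ E :=
  (BanachLattice.dualPosAddHom f).toRealLinearMap
    (AddMonoidHomClass.continuous_of_bound (BanachLattice.dualPosAddHom f) ‖f‖
      (BanachLattice.dualPosAddHom_bound f))

theorem BanachLattice.dualPos_apply (f : StrongDual ℝ E) {x : E} (hx : 0 ≤ x) :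
    BanachLattice.dualPos f x = BanachLattice.rk f x := by
  change BanachLattice.rk f x⁺ - BanachLattice.rk f x⁻ = BanachLattice.rk f x
  have h0 : BanachLattice.rk f (0 : E) = 0 := by simp [BanachLattice.rk]
  rw [posPart_of_nonneg hx, negPart_of_nonneg hx, h0, sub_zero]

/-- The lattice structure of the dual for the canonical order, with `f ⊔ g = g + (f - g)⁺`. -/
noncomputable instance BanachLattice.dualLattice : Lattice (StrongDual ℝ E) :=
  have hl : ∀ f g : StrongDual ℝ E, f ≤ g + BanachLattice.dualPos (f - g) := fun f g x hx => by
    have := BanachLattice.le_rk (f - g) hx le_rfl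
    have e := BanachLattice.dualPos_apply (f - g) hx
    rw [sub_apply] at this
    rw [add_apply, e]
    linarith
  have hr : ∀ f g : StrongDual ℝ E, g ≤ g + BanachLattice.dualPos (f - g) := fun f g x hx => by
    have := BanachLattice.rk_nonneg (f - g) hx
    have e := BanachLattice.dualPos_apply (f - g) hx
    rw [add_apply, e]
    linarith
  have hs : ∀ f g h : StrongDual ℝ E, f ≤ h → g ≤ h → g + BanachLattice.dualPos (f - g) ≤ h :=
    fun f g h hf hg x hx => by
      have : BanachLattice.rk (f - g) x ≤ h x - g x := by
        refine BanachLattice.rk_le _ hx fun y hy0 hy => ?_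
        have h1 := hf y hy0
        have h2 := hg (x - y) (sub_nonneg.2 hy)
        rw [map_sub, map_sub] at h2
        rw [sub_apply]
        linarith
      have e := BanachLattice.dualPos_apply (f - g) hx
      rw [add_apply, e]
      linarith
  { BanachLattice.dualPartialOrder with
    sup := fun f g => g + BanachLattice.dualPos (f - g)
    inf := fun f g => -(-g + BanachLattice.dualPos (-f - -g))
    le_sup_left := hl
    le_sup_right := hr
    sup_le := hs
    inf_le_left := fun f g => neg_le.1 (hl (-f) (-g))
    inf_le_right := fun f g => neg_le.1 (hr (-f) (-g))
    le_inf := fun f g h hfg hfh =>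
      le_neg.1 (hs (-g) (-h) (-f) (neg_le_neg hfg) (neg_le_neg hfh)) }

end DualLattice

/-! ### Sequences, sets and operators -/

/-- `xₙ → 0` in the weak topology. -/
def WeaklyNull {E : Type*} [NormedAddCommGroup E] [NormedSpace ℝ E] (x : ℕ → E) : Prop :=
  Tendsto (fun n => toWeakSpace ℝ E (x n)) atTop (𝓝 0)

/-- `fₙ → f` in the weak* topology of the dual. -/
def WeakStarTendsto {E : Type*} [NormedAddCommGroup E] [NormedSpace ℝ E]
    (f : ℕ → StrongDual ℝ E) (g : StrongDual ℝ E) : Prop :=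
  Tendsto (fun n => StrongDual.toWeakDual (f n)) atTop (𝓝 (StrongDual.toWeakDual g))

/-- `fₙ → 0` in the weak* topology of the dual. -/
def WeakStarNull {E : Type*} [NormedAddCommGroup E] [NormedSpace ℝ E]
    (f : ℕ → StrongDual ℝ E) : Prop :=
  WeakStarTendsto f 0

/-- A sequence with pairwise disjoint terms. -/
def DisjointSeq {L : Type*} [AddCommGroup L] [Lattice L] (x : ℕ → L) : Prop :=
  ∀ n m, n ≠ m → |x n| ⊓ |x m| = 0

/-- A set whose closure in the weak topology is weakly compact. -/
def RelWeaklyCompact {E : Type*} [NormedAddCommGroup E] [NormedSpace ℝ E] (W : Set E) : Prop :=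
  IsCompact (closure (toWeakSpace ℝ E '' W))

section Lattice

variable {E : Type*} [NormedAddCommGroup E] [NormedSpace ℝ E] [Lattice E] [HasSolidNorm E]
  [IsOrderedAddMonoid E]

/-- A norm bounded set on which every disjoint weak* null sequence of functionals converges
uniformly to zero. -/
def AlmostLimited (A : Set E) : Prop :=
  Bornology.IsBounded A ∧
    ∀ f : ℕ → StrongDual ℝ E, DisjointSeq f → WeakStarNull f →
      TendstoUniformlyOn (fun n x => f n x) (fun _ => (0 : ℝ)) atTop A

variable (E) in
/-- Property (d): `|fₙ|` is weak* null for every disjoint weak* null sequence `(fₙ)`. -/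
def PropertyD : Prop :=
  ∀ f : ℕ → StrongDual ℝ E, DisjointSeq f → WeakStarNull f → WeakStarNull (fun n => |f n|)

variable (E) in
/-- The lattice operations of the dual are sequentially weak* continuous. -/
def DualLatticeOpsSeqWeakStarContinuous : Prop :=
  ∀ (f g : ℕ → StrongDual ℝ E) (f₀ g₀ : StrongDual ℝ E),
    WeakStarTendsto f f₀ → WeakStarTendsto g g₀ →
      WeakStarTendsto (fun n => f n ⊔ g n) (f₀ ⊔ g₀) ∧
      WeakStarTendsto (fun n => f n ⊓ g n) (f₀ ⊓ g₀)

/-- An operator from a Banach space to a Banach lattice that carries relatively weakly compact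
sets to almost limited sets. -/
def WeakAlmostLimited {X : Type*} [NormedAddCommGroup X] [NormedSpace ℝ X] (T : X →L[ℝ] E) :
    Prop :=
  ∀ W : Set X, RelWeaklyCompact W → AlmostLimited (T '' W)

end Lattice

/-- An operator that maps order intervals into order intervals. -/
def OrderBoundedOp {E F : Type*} [NormedAddCommGroup E] [NormedSpace ℝ E] [Lattice E]
    [NormedAddCommGroup F] [NormedSpace ℝ F] [Lattice F] (T : E →L[ℝ] F) : Prop :=
  ∀ a b : E, ∃ c d : F, T '' Icc a b ⊆ Icc c d

/-! The substance is that testing on positive disjoint weakly null sequences already controls `T` on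
solid hulls of relatively weakly compact sets; the other implications are formal, because the range
of a weakly null sequence is relatively weakly compact and `W` lies in its solid hull.

Let `f n` be disjoint and weak* null, and put `g n = (f n).comp T`. Either alternative in the
hypothesis makes `|g n|` weak* null. If `g n` were not uniformly small on the solid hull of `W`,
some `v n` there would satisfy `ε ≤ |g n (v n)|` along a subsequence. Since `|g n|` is weak* null,
the vectors `|v n|` can be disjointified at the cost of half of `ε` (`exists_disjointSeq_le`).
Positive disjoint sequences in the solid hull are weakly null
(`RelWeaklyCompact.weaklyNull_of_disjointSeq`), and the Riesz–Kantorovich formula replaces `|g n|`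
by `g n`, contradicting the test.

The weak nullity rests on a Phillips-type lemma, `RelWeaklyCompact.tendsto_apply_zero`, proved by
Baire category on the Cantor space; Hahn–Banach supplies the functionals it is applied to. -/

/-! ### Weak and weak* convergence; relatively weakly compact sets. -/

section WeakTopologies

variable {X : Type*} [NormedAddCommGroup X] [NormedSpace ℝ X]

theorem tendsto_toWeakSpace_iff {ι : Type*} {l : Filter ι} {x : ι → X} {a : X} :
    Tendsto (fun n => toWeakSpace ℝ X (x n)) l (𝓝 (toWeakSpace ℝ X a)) ↔
      ∀ f : StrongDual ℝ X, Tendsto (fun n => f (x n)) l (𝓝 (f a)) := by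
  have hinj : Function.Injective (topDualPairing ℝ X).flip := fun x y hxy => by
    by_contra hne
    obtain ⟨f, hf⟩ := SeparatingDual.exists_separating_of_ne (R := ℝ) hne
    exact hf (LinearMap.congr_fun hxy f)
  exact WeakBilin.tendsto_iff_forall_eval_tendsto (topDualPairing ℝ X).flip hinj

theorem weaklyNull_iff {x : ℕ → X} :
    WeaklyNull x ↔ ∀ f : StrongDual ℝ X, Tendsto (fun n => f (x n)) atTop (𝓝 0) := by
  have := tendsto_toWeakSpace_iff (l := atTop) (x := x) (a := 0)
  simp only [map_zero] at this
  exact this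

theorem weakStarTendsto_iff {f : ℕ → StrongDual ℝ X} {g : StrongDual ℝ X} :
    WeakStarTendsto f g ↔ ∀ x : X, Tendsto (fun n => f n x) atTop (𝓝 (g x)) :=
  tendsto_iff_forall_eval_tendsto_topDualPairing

theorem weakStarNull_iff {f : ℕ → StrongDual ℝ X} :
    WeakStarNull f ↔ ∀ x : X, Tendsto (fun n => f n x) atTop (𝓝 0) :=
  weakStarTendsto_iff

theorem continuous_apply_toWeakSpace_symm (f : StrongDual ℝ X) :
    Continuous fun z : WeakSpace ℝ X => f ((toWeakSpace ℝ X).symm z) :=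
  WeakBilin.eval_continuous (topDualPairing ℝ X).flip f

theorem RelWeaklyCompact.range_of_weaklyNull {x : ℕ → X} (hx : WeaklyNull x) :
    RelWeaklyCompact (range x) := by
  refine (Tendsto.isCompact_insert_range hx).closure_of_subset ?_
  rintro _ ⟨_, ⟨n, rfl⟩, rfl⟩
  exact mem_insert_of_mem _ ⟨n, rfl⟩

/-- One weak cluster point serves all functionals at once. This is the only form of compactness
used, so no weakly convergent subsequence has to be extracted. -/
theorem RelWeaklyCompact.exists_mapClusterPt {W : Set X} (hW : RelWeaklyCompact W) {y : ℕ → X}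
    (hy : ∀ n, y n ∈ W) :
    ∃ z : X, ∀ f : StrongDual ℝ X, MapClusterPt (f z) atTop (fun n => f (y n)) := by
  obtain ⟨z, -, hz⟩ := IsCompact.exists_mapClusterPt hW (f := atTop) (u := fun n => toWeakSpace ℝ X (y n))
    (tendsto_principal.2 (Eventually.of_forall fun n => subset_closure ⟨y n, hy n, rfl⟩))
  exact ⟨(toWeakSpace ℝ X).symm z, fun f =>
    MapClusterPt.continuousAt_comp (f := fun z : WeakSpace ℝ X => f ((toWeakSpace ℝ X).symm z))
      (continuous_apply_toWeakSpace_symm f).continuousAt hz⟩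

/-- Uniform boundedness for `W` acting on the dual, which is complete even if `X` is not. -/
theorem RelWeaklyCompact.exists_norm_le {W : Set X} (hW : RelWeaklyCompact W) :
    ∃ C, ∀ w ∈ W, ‖w‖ ≤ C := by
  obtain ⟨C, hC⟩ := banach_steinhaus
    (g := fun w : W => NormedSpace.inclusionInDoubleDual ℝ X (w : X)) (fun f => by
      obtain ⟨C, hC⟩ := (IsCompact.image hW
        (continuous_apply_toWeakSpace_symm f).norm).bddAbove
      exact ⟨C, fun w => hC ⟨toWeakSpace ℝ X w, subset_closure ⟨w, w.2, rfl⟩, rfl⟩⟩)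
  refine ⟨C, fun w hw => ?_⟩
  rw [← (NormedSpace.inclusionInDoubleDualLi (E := X) ℝ).norm_map w]
  exact hC ⟨w, hw⟩

end WeakTopologies

/-! ### Weakly unconditionally summable functionals on relatively weakly compact sets. -/

section UnconditionallyBounded

variable {X : Type*} [NormedAddCommGroup X] [NormedSpace ℝ X]

/-- Every subfamily of a weakly unconditionally summable sequence of functionals has a pointwise
sum in the dual. -/
theorem exists_strongDual_tsum {h : ℕ → StrongDual ℝ X} {C : ℝ}
    (hC : ∀ (s : Finset ℕ) (v : X), ∑ i ∈ s, |h i v| ≤ C * ‖v‖) (s : ℕ → Bool) :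
    ∃ φ : StrongDual ℝ X, ∀ v, φ v = ∑' i, if s i then h i v else 0 := by
  have habs : ∀ v, Summable fun i => |h i v| := fun v =>
    summable_of_sum_le (fun i => abs_nonneg _) fun u => hC u v
  have hsum : ∀ v, Summable fun i => if s i then h i v else 0 := fun v =>
    Summable.of_norm_bounded (habs v) fun i => by
      split_ifs
      · exact le_rfl
      · simp
  refine ⟨LinearMap.mkContinuous
    { toFun := fun v => ∑' i, if s i then h i v else 0
      map_add' := fun v w => ?_
      map_smul' := fun c v => ?_ } C fun v => ?_, fun v => rfl⟩
  · rw [← (hsum v).tsum_add (hsum w)]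
    refine tsum_congr fun i => ?_
    split_ifs <;> simp
  · rw [RingHom.id_apply, smul_eq_mul, ← tsum_mul_left]
    refine tsum_congr fun i => ?_
    split_ifs <;> simp
  · refine (norm_tsum_le_tsum_norm (hsum v).norm).trans ?_
    refine ((hsum v).norm.tsum_le_tsum (fun i => ?_) (habs v)).trans
      ((habs v).tsum_le_of_sum_le fun u => hC u v)
    split_ifs
    · exact le_rfl
    · simp

/-- Every subset `s` of the indices gives a functional `φ s`, the sum of the `h i` over `s`, and `φ
s (y n)` converges for each `s`. Baire category on `ℕ → Bool` makes this uniform on a cylinder, and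
flipping one free coordinate isolates `h i`. -/
theorem RelWeaklyCompact.exists_uniform_limit {W : Set X} (hW : RelWeaklyCompact W)
    {h : ℕ → StrongDual ℝ X} {C : ℝ}
    (hC : ∀ (s : Finset ℕ) (v : X), ∑ i ∈ s, |h i v| ≤ C * ‖v‖)
    {y : ℕ → X} (hy : ∀ n, y n ∈ W) {c : ℕ → ℝ}
    (hc : ∀ i, Tendsto (fun n => h i (y n)) atTop (𝓝 (c i))) :
    ∃ z : X, ∀ ε > 0, ∃ N M, ∀ n ≥ N, ∀ i ≥ M, |h i (y n) - h i z| ≤ ε := by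
  choose φ hφ using exists_strongDual_tsum hC
  have habs : ∀ v, Summable fun i => |h i v| := fun v =>
    summable_of_sum_le (fun i => abs_nonneg _) fun u => hC u v
  have hlim : ∀ {z : X} {σ : ℕ → ℕ}, Tendsto σ atTop atTop →
      (∀ f : StrongDual ℝ X, MapClusterPt (f z) atTop (fun n => f (y (σ n)))) →
      ∀ i, h i z = c i := fun {z σ} hσ hz i => by
    have h1 := (hc i).comp hσ
    by_contra hne
    have : Disjoint (𝓝 (h i z)) (𝓝 (c i)) := disjoint_nhds_nhds.2 hne
    exact (hz (h i)).neBot.ne ((this.mono_right h1).eq_bot)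
  obtain ⟨z, hz⟩ := hW.exists_mapClusterPt hy
  have hz' := hlim (σ := id) tendsto_id hz
  -- A subsequence staying away from `φ s z` would have a cluster point `z'`. All `h i` agree at `z`
  -- and `z'`, hence so does `φ s`.
  have key : ∀ s, Tendsto (fun n => φ s (y n)) atTop (𝓝 (φ s z)) := fun s => by
    by_contra hnot
    obtain ⟨U, hU, hfreq⟩ : ∃ U ∈ 𝓝 (φ s z), ∃ᶠ n in atTop, φ s (y n) ∉ U :=
      not_tendsto_iff_exists_frequently_notMem.1 hnot
    obtain ⟨σ, hσ, hσU⟩ := extraction_of_frequently_atTop hfreq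
    obtain ⟨z', hz''⟩ := hW.exists_mapClusterPt fun n => hy (σ n)
    have he : φ s z' = φ s z := by
      rw [hφ, hφ]
      exact tsum_congr fun i => by rw [hz' i, hlim hσ.tendsto_atTop hz'' i]
    have := (hz'' (φ s)).frequently (he ▸ hU)
    exact this (Eventually.of_forall hσU)
  refine ⟨z, fun ε hε => ?_⟩
  let K : ℕ → Set (ℕ → Bool) := fun N => {s | ∀ n ≥ N, |φ s (y n) - φ s z| ≤ ε / 2}
  have hcont : ∀ v, Continuous fun s => φ s v := fun v => by
    simp only [hφ]
    refine continuous_tsum (fun i => ?_) (habs v) fun i s => ?_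
    · exact (continuous_of_discreteTopology (f := fun b : Bool => if b then h i v else 0)).comp
        (continuous_apply i)
    · split_ifs
      · exact le_rfl
      · simp
  have hclosed : ∀ N, IsClosed (K N) := fun N => by
    simp only [K, ofPred_forall]
    exact isClosed_iInter fun n => isClosed_iInter fun _ =>
      isClosed_le ((hcont _).sub (hcont _)).abs continuous_const
  have hcover : ⋃ N, K N = univ := by
    refine eq_univ_of_forall fun s => mem_iUnion.2 ?_
    obtain ⟨N, hN⟩ := Metric.tendsto_atTop.1 (key s) (ε / 2) (by positivity)
    exact ⟨N, fun n hn => (hN n hn).le⟩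
  obtain ⟨N, s, hs⟩ := nonempty_interior_of_iUnion_of_closed hclosed hcover
  obtain ⟨I, u, hu, hsub⟩ := isOpen_pi_iff.1 isOpen_interior s hs
  obtain ⟨M, hM⟩ := I.exists_nat_subset_range
  refine ⟨N, M, fun n hn i hi => ?_⟩
  have hiI : i ∉ I := fun hmem => by
    have := Finset.mem_range.1 (hM hmem)
    omega
  -- The cylinder constrains only coordinates in `I`, so both values at `i` stay in `K N`; the two
  -- errors of `ε / 2` add up to `ε`.
  have hmem : ∀ b, Function.update s i b ∈ K N := fun b =>
    interior_subset (hsub fun j hj => by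
      have hji : j ≠ i := fun e => hiI (e ▸ hj)
      rw [Function.update_of_ne hji]
      exact (hu j hj).2)
  have hdiff : ∀ v, φ (Function.update s i true) v - φ (Function.update s i false) v = h i v := by
    intro v
    have hsum : ∀ s : ℕ → Bool, Summable fun i => if s i then h i v else 0 := fun s =>
      Summable.of_norm_bounded (habs v) fun i => by
        split_ifs
        · exact le_rfl
        · simp
    rw [hφ, hφ, ← (hsum _).tsum_sub (hsum _), tsum_eq_single i]
    · simp
    · intro j hj
      simp [Function.update_of_ne hj]
  have h1 := abs_le.1 (hmem true n hn)
  have h2 := abs_le.1 (hmem false n hn)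
  rw [← hdiff, ← hdiff, abs_le]
  constructor <;> linarith

/-- A weakly unconditionally summable sequence of functionals tends to zero along every sequence
taken from a relatively weakly compact set. -/
theorem RelWeaklyCompact.tendsto_apply_zero {W : Set X} (hW : RelWeaklyCompact W)
    {h : ℕ → StrongDual ℝ X} {C : ℝ}
    (hC : ∀ (s : Finset ℕ) (v : X), ∑ i ∈ s, |h i v| ≤ C * ‖v‖)
    {y : ℕ → X} (hy : ∀ n, y n ∈ W) : Tendsto (fun n => h n (y n)) atTop (𝓝 0) := by
  obtain ⟨B, hB⟩ := hW.exists_norm_le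
  refine tendsto_of_subseq_tendsto fun ns hns => ?_
  -- Diagonal extraction via Tychonoff: along `σ` every coordinate `h i` converges.
  have hcomp : IsCompact (univ.pi fun i : ℕ => Icc (-(‖h i‖ * B)) (‖h i‖ * B)) :=
    isCompact_univ_pi fun i => isCompact_Icc
  obtain ⟨c, -, σ, hσ, hlim⟩ := hcomp.tendsto_subseq (x := fun n i => h i (y (ns n)))
    (fun n i _ => abs_le.1 (((h i).le_opNorm _).trans
      (mul_le_mul_of_nonneg_left (hB _ (hy _)) (norm_nonneg _))))
  obtain ⟨z, hz⟩ := hW.exists_uniform_limit hC (y := fun n => y (ns (σ n))) (fun n => hy _)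
    (fun i => (tendsto_pi_nhds.1 hlim) i)
  have hzero : Tendsto (fun i => h i z) atTop (𝓝 0) := by
    have hs : Summable fun i => |h i z| :=
      summable_of_sum_le (fun i => abs_nonneg _) fun u => hC u z
    exact (tendsto_zero_iff_abs_tendsto_zero _).2 hs.tendsto_atTop_zero
  have hidx := hns.comp hσ.tendsto_atTop
  have hdiff : Tendsto (fun n => h (ns (σ n)) (y (ns (σ n))) - h (ns (σ n)) z) atTop (𝓝 0) := by
    refine Metric.tendsto_atTop.2 fun ε hε => ?_
    obtain ⟨N, M, hNM⟩ := hz (ε / 2) (by positivity)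
    obtain ⟨N', hN'⟩ := eventually_atTop.1 (hidx.eventually_ge_atTop M)
    refine ⟨max N N', fun n hn => ?_⟩
    have := hNM n (le_of_max_le_left hn) _ (hN' n (le_of_max_le_right hn))
    rw [Real.dist_eq, sub_zero]
    simp only [Function.comp_apply] at this
    linarith
  exact ⟨σ, by simpa using hdiff.add (hzero.comp hidx)⟩

end UnconditionallyBounded

/-! ### Disjointness and disjointification in vector lattices. -/

section VectorLattice

set_option linter.unusedSectionVars false

variable {L : Type*} [AddCommGroup L] [Lattice L] [IsOrderedAddMonoid L]

theorem inf_add_le_inf_add_inf {a b c : L} (ha : 0 ≤ a) (hb : 0 ≤ b) (hc : 0 ≤ c) :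
    a ⊓ (b + c) ≤ a ⊓ b + a ⊓ c := by
  have h1 : a ⊓ (b + c) ≤ a ⊓ b + c := by
    rw [← sub_le_iff_le_add]
    exact le_inf ((sub_le_self _ hc).trans inf_le_left)
      (sub_le_iff_le_add.2 inf_le_right)
  have h2 : a ⊓ (b + c) ≤ a ⊓ b + a :=
    inf_le_left.trans (le_add_of_nonneg_left (le_inf ha hb))
  calc a ⊓ (b + c) ≤ (a ⊓ b + a) ⊓ (a ⊓ b + c) := le_inf h2 h1
    _ = a ⊓ b + a ⊓ c := (add_inf _ _ _).symm

theorem add_eq_sup_of_inf_eq_zero {a b : L} (h : a ⊓ b = 0) : a + b = a ⊔ b := by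
  rw [← inf_add_sup a b, h, zero_add]

theorem inf_sum_eq_zero {ι : Type*} {a : L} {b : ι → L} (ha : 0 ≤ a)
    (hb : ∀ i, 0 ≤ b i) (s : Finset ι) (h : ∀ i ∈ s, a ⊓ b i = 0) : a ⊓ ∑ i ∈ s, b i = 0 := by
  classical
  induction s using Finset.induction_on with
  | empty => simpa using ha
  | insert i s his ih =>
    rw [Finset.sum_insert his]
    have hs : 0 ≤ ∑ j ∈ s, b j := Finset.sum_nonneg fun j _ => hb j
    refine le_antisymm ?_ (le_inf ha (add_nonneg (hb i) hs))
    refine (inf_add_le_inf_add_inf ha (hb i) hs).trans ?_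
    rw [h i (Finset.mem_insert_self _ _), ih fun j hj => h j (Finset.mem_insert_of_mem hj),
      add_zero]

theorem sum_le_of_pairwise_disjoint {ι : Type*} {b : ι → L} {y : L} (hb : ∀ i, 0 ≤ b i)
    (hdisj : ∀ i j, i ≠ j → b i ⊓ b j = 0) (hby : ∀ i, b i ≤ y) (hy : 0 ≤ y) (s : Finset ι) :
    ∑ i ∈ s, b i ≤ y := by
  classical
  induction s using Finset.induction_on with
  | empty => simpa using hy
  | insert i s his ih =>
    rw [Finset.sum_insert his, add_eq_sup_of_inf_eq_zero
      (inf_sum_eq_zero (hb i) hb s fun j hj => hdisj i j fun e => his (e ▸ hj))]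
    exact sup_le (hby i) ih

theorem DisjointSeq.mono {x y : ℕ → L} (hx : DisjointSeq x) (h : ∀ n, |y n| ≤ |x n|) :
    DisjointSeq y := fun n m hnm =>
  le_antisymm ((inf_le_inf (h n) (h m)).trans (hx n m hnm).le)
    (le_inf (abs_nonneg _) (abs_nonneg _))

theorem DisjointSeq.comp {x : ℕ → L} (hx : DisjointSeq x) {σ : ℕ → ℕ}
    (hσ : Function.Injective σ) : DisjointSeq fun n => x (σ n) :=
  fun _ _ hnm => hx _ _ (hσ.ne hnm)

theorem DisjointSeq.inf_eq_zero {x : ℕ → L} (hx : DisjointSeq x) (h0 : ∀ n, 0 ≤ x n) {n m : ℕ}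
    (hnm : n ≠ m) : x n ⊓ x m = 0 := by
  have := hx n m hnm
  rwa [abs_of_nonneg (h0 n), abs_of_nonneg (h0 m)] at this

theorem abs_posPart_le (x : L) : |x⁺| ≤ |x| := by
  rw [abs_of_nonneg (posPart_nonneg x), ← posPart_add_negPart x]
  exact le_add_of_nonneg_right (negPart_nonneg x)

theorem abs_negPart_le (x : L) : |x⁻| ≤ |x| := by
  rw [abs_of_nonneg (negPart_nonneg x), ← posPart_add_negPart x]
  exact le_add_of_nonneg_left (posPart_nonneg x)

theorem posPart_le_posPart_of_le {x y : L} (h : x ≤ y) : x⁺ ≤ y⁺ := by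
  rw [posPart_def, posPart_def]
  exact sup_le_sup_right h 0

variable [Module ℝ L] [IsOrderedModule ℝ L]

theorem abs_smul_le {c : ℝ} (hc : 0 ≤ c) (x : L) : |c • x| ≤ c • |x| :=
  abs_le'.2 ⟨smul_le_smul_of_nonneg_left (le_abs_self x) hc, by
    rw [← smul_neg]
    exact smul_le_smul_of_nonneg_left (neg_le_abs x) hc⟩

theorem inv_smul_le_of_le_smul' {c : ℝ} (hc : 0 < c) {x y : L} (h : x ≤ c • y) :
    c⁻¹ • x ≤ y := by
  have := smul_le_smul_of_nonneg_left h (inv_nonneg.2 hc.le)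
  rwa [inv_smul_smul₀ hc.ne'] at this

theorem smul_inf_smul_eq_zero {a b : L} (ha : 0 ≤ a) (hb : 0 ≤ b) (h : a ⊓ b = 0) {s t : ℝ}
    (hs : 0 ≤ s) (ht : 0 ≤ t) : (s • a) ⊓ (t • b) = 0 := by
  refine le_antisymm ?_ (le_inf (smul_nonneg hs ha) (smul_nonneg ht hb))
  have hM : 0 < s + t + 1 := by positivity
  have h1 : (s • a) ⊓ (t • b) ≤ (s + t + 1) • a :=
    inf_le_left.trans (smul_le_smul_of_nonneg_right (by linarith) ha)
  have h2 : (s • a) ⊓ (t • b) ≤ (s + t + 1) • b :=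
    inf_le_right.trans (smul_le_smul_of_nonneg_right (by linarith) hb)
  have h3 := le_inf (inv_smul_le_of_le_smul' hM h1) (inv_smul_le_of_le_smul' hM h2)
  rw [h] at h3
  have := smul_le_smul_of_nonneg_left h3 hM.le
  rwa [smul_inv_smul₀ hM.ne', smul_zero] at this

/-- The disjointification of a sequence of positive vectors. -/
theorem disjointSeq_posPart_sub {z Y : ℕ → L} {Z : L} (hz : ∀ n, 0 ≤ z n)
    (hZ : ∀ n, (2⁻¹ : ℝ) ^ n • z n ≤ Z)
    (hY : ∀ k m, k < m → (4 : ℝ) ^ m • z k ≤ Y m) (hY0 : ∀ m, 0 ≤ Y m) :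
    DisjointSeq fun m => (z m - Y m - (2⁻¹ : ℝ) ^ m • Z)⁺ := by
  have hZ0 : 0 ≤ Z := by simpa using (hz 0).trans (by simpa using hZ 0)
  -- The two terms are dominated by the negative and positive parts of the single vector `z m - 4 ^
  -- m • z k`. Subtracting `Y m` handles the later term, subtracting `2⁻¹ ^ k • Z` the earlier one.
  have key : ∀ k m, k < m →
      (z k - Y k - (2⁻¹ : ℝ) ^ k • Z)⁺ ⊓ (z m - Y m - (2⁻¹ : ℝ) ^ m • Z)⁺ ≤ 0 := by
    intro k m hkm
    have hm : (z m - Y m - (2⁻¹ : ℝ) ^ m • Z)⁺ ≤ (z m - (4 : ℝ) ^ m • z k)⁺ := by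
      refine posPart_le_posPart_of_le ((sub_le_self _ (smul_nonneg (by positivity) hZ0)).trans ?_)
      exact sub_le_sub_left (hY k m hkm) _
    have hk : (z k - Y k - (2⁻¹ : ℝ) ^ k • Z)⁺ ≤ (z m - (4 : ℝ) ^ m • z k)⁻ := by
      rw [posPart_def]
      refine sup_le ?_ (negPart_nonneg _)
      have hc : (1 : ℝ) ≤ 2 ^ (k + m) := one_le_pow₀ one_le_two
      -- The base 4 is chosen because `k < m` gives `k + m ≤ 2 * m`.
      have hc4 : (2 : ℝ) ^ (k + m) ≤ 4 ^ m := by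
        rw [show (4 : ℝ) = 2 ^ 2 by norm_num, ← pow_mul]
        exact pow_le_pow_right₀ one_le_two (by omega)
      have hc' : (2 : ℝ) ^ (k + m) ≠ 0 := by positivity
      have hinv : (2⁻¹ : ℝ) ^ k * (2⁻¹ : ℝ) ^ m = ((2 : ℝ) ^ (k + m))⁻¹ := by
        rw [← pow_add, inv_pow]
      have hZm : ((2 : ℝ) ^ (k + m))⁻¹ • z m ≤ (2⁻¹ : ℝ) ^ k • Z := by
        rw [← hinv, mul_smul]
        exact smul_le_smul_of_nonneg_left (hZ m) (by positivity)
      have hneg : (2 : ℝ) ^ (k + m) • z k - z m ≤ (z m - (4 : ℝ) ^ m • z k)⁻ := by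
        refine le_trans ?_ (neg_le_negPart _)
        rw [neg_sub]
        exact sub_le_sub_right (smul_le_smul_of_nonneg_right hc4 (hz k)) _
      calc z k - Y k - (2⁻¹ : ℝ) ^ k • Z
          ≤ z k - ((2 : ℝ) ^ (k + m))⁻¹ • z m :=
            (sub_le_sub_right (sub_le_self _ (hY0 k)) _).trans (sub_le_sub_left hZm _)
        _ = ((2 : ℝ) ^ (k + m))⁻¹ • ((2 : ℝ) ^ (k + m) • z k - z m) := by
            rw [smul_sub, inv_smul_smul₀ hc']
        _ ≤ ((2 : ℝ) ^ (k + m))⁻¹ • (z m - (4 : ℝ) ^ m • z k)⁻ :=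
            smul_le_smul_of_nonneg_left hneg (by positivity)
        _ ≤ (1 : ℝ) • (z m - (4 : ℝ) ^ m • z k)⁻ :=
            smul_le_smul_of_nonneg_right (inv_le_one_of_one_le₀ hc) (negPart_nonneg _)
        _ = _ := one_smul _ _
    calc _ ≤ (z m - (4 : ℝ) ^ m • z k)⁻ ⊓ (z m - (4 : ℝ) ^ m • z k)⁺ := inf_le_inf hk hm
      _ = 0 := by rw [inf_comm, posPart_inf_negPart_eq_zero]
  intro k m hkm
  rw [abs_of_nonneg (posPart_nonneg _), abs_of_nonneg (posPart_nonneg _)]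
  refine le_antisymm ?_ (le_inf (posPart_nonneg _) (posPart_nonneg _))
  rcases lt_or_gt_of_ne hkm with h | h
  · exact key k m h
  · rw [inf_comm]
    exact key m k h

end VectorLattice

/-! ### The modulus of a functional. -/

section DualModulus

set_option linter.unusedSectionVars false

variable {E : Type*} [NormedAddCommGroup E] [NormedSpace ℝ E] [Lattice E] [HasSolidNorm E]
  [IsOrderedAddMonoid E]

theorem dual_abs_apply (g : StrongDual ℝ E) {x : E} (hx : 0 ≤ x) :
    |g| x = -g x + BanachLattice.rk (g - -g) x := by
  rw [← BanachLattice.dualPos_apply _ hx]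
  rfl

theorem dual_apply_le_apply {f : StrongDual ℝ E} (hf : 0 ≤ f) {x y : E} (h : x ≤ y) :
    f x ≤ f y := by
  have : 0 ≤ f (y - x) := hf (y - x) (sub_nonneg.2 h)
  rw [map_sub] at this
  linarith

theorem abs_dual_apply_le (g : StrongDual ℝ E) (y : E) : |g y| ≤ |g| |y| := by
  have hle : g ≤ |g| := le_abs_self g
  have hneg : -g ≤ |g| := neg_le_abs g
  have h1 := hle _ (posPart_nonneg y)
  have h2 := hle _ (negPart_nonneg y)
  have h3 : -g y⁺ ≤ _ := hneg _ (posPart_nonneg y)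
  have h4 : -g y⁻ ≤ _ := hneg _ (negPart_nonneg y)
  have h5 : g y = g y⁺ - g y⁻ := by rw [← map_sub, posPart_sub_negPart]
  rw [← posPart_add_negPart y, map_add, h5, abs_le]
  constructor <;> linarith

/-- Since `|g| = -g + (2g)⁺`, the value `|g| x` is the supremum of `2 * g t - g x` over `0 ≤ t ≤ x`.
This recovers the size of `|g|` from values of `g` on positive vectors. -/
theorem exists_lt_two_mul_sub (g : StrongDual ℝ E) {x : E} (hx : 0 ≤ x) {ε : ℝ} (hε : 0 < ε) :
    ∃ t, 0 ≤ t ∧ t ≤ x ∧ |g| x - ε < 2 * g t - g x := by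
  have hlt : BanachLattice.rk (g - -g) x - ε < BanachLattice.rk (g - -g) x := by linarith
  obtain ⟨_, ⟨t, ht, rfl⟩, h⟩ := exists_lt_of_lt_csSup
    ((nonempty_Icc.2 hx).image (g - -g)) hlt
  refine ⟨t, ht.1, ht.2, ?_⟩
  have h' : BanachLattice.rk (g - -g) x - ε < g t - -g t := h
  rw [dual_abs_apply g hx]
  linarith

theorem dual_abs_apply_le (g : StrongDual ℝ E) {x : E} (hx : 0 ≤ x) {c : ℝ}
    (h : ∀ y, |y| ≤ x → g y ≤ c) : |g| x ≤ c := by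
  refine le_of_forall_pos_le_add fun ε hε => ?_
  obtain ⟨t, h0, ht, hlt⟩ := exists_lt_two_mul_sub g hx hε
  have := h (t + t - x) (abs_le'.2 ⟨?_, ?_⟩)
  · rw [map_sub, map_add] at this
    linarith
  · rw [sub_le_iff_le_add]
    exact add_le_add ht ht
  · rw [neg_sub]
    exact sub_le_self _ (add_nonneg h0 h0)

end DualModulus

/-! ### Disjoint sequences in solid hulls of relatively weakly compact sets. -/

section SolidHull

set_option linter.unusedSectionVars false

variable {E : Type*} [NormedAddCommGroup E] [NormedSpace ℝ E] [Lattice E] [HasSolidNorm E]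
  [IsOrderedAddMonoid E] [IsOrderedModule ℝ E]

/-- The component of a positive functional on the band generated by `x`, as a seminorm. -/
noncomputable def bandSeminorm (f : StrongDual ℝ E) (x y : E) : ℝ :=
  ⨆ t : NNReal, f (|y| ⊓ (t : ℝ) • x)

theorem bandSeminorm_bddAbove {f : StrongDual ℝ E} (hf : 0 ≤ f) (x y : E) :
    BddAbove (range fun t : NNReal => f (|y| ⊓ (t : ℝ) • x)) := by
  refine ⟨f |y|, ?_⟩
  rintro _ ⟨t, rfl⟩
  exact dual_apply_le_apply hf inf_le_left

theorem le_bandSeminorm {f : StrongDual ℝ E} (hf : 0 ≤ f) {x y w : E} {t : ℝ} (ht : 0 ≤ t)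
    (h1 : w ≤ |y|) (h2 : w ≤ t • x) : f w ≤ bandSeminorm f x y :=
  (dual_apply_le_apply hf (le_inf h1 h2)).trans
    (le_ciSup (bandSeminorm_bddAbove hf x y) (⟨t, ht⟩ : NNReal))

theorem bandSeminorm_add_le {f : StrongDual ℝ E} (hf : 0 ≤ f) {x : E} (hx : 0 ≤ x) (y z : E) :
    bandSeminorm f x (y + z) ≤ bandSeminorm f x y + bandSeminorm f x z := by
  refine ciSup_le fun t => ?_
  have htx : 0 ≤ (t : ℝ) • x := smul_nonneg t.2 hx
  have h : |y + z| ⊓ (t : ℝ) • x ≤ |y| ⊓ (t : ℝ) • x + |z| ⊓ (t : ℝ) • x := by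
    rw [inf_comm, inf_comm |y|, inf_comm |z|]
    exact (inf_le_inf_left _ (abs_add_le y z)).trans
      (inf_add_le_inf_add_inf htx (abs_nonneg y) (abs_nonneg z))
  refine (dual_apply_le_apply hf h).trans ?_
  rw [map_add]
  exact add_le_add (le_bandSeminorm hf t.2 inf_le_left inf_le_right)
    (le_bandSeminorm hf t.2 inf_le_left inf_le_right)

theorem bandSeminorm_smul_le {f : StrongDual ℝ E} (hf : 0 ≤ f) {x : E} {c : ℝ}
    (hc : 0 < c) (y : E) : bandSeminorm f x (c • y) ≤ c * bandSeminorm f x y := by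
  refine ciSup_le fun t => ?_
  have h1 : |c • y| ⊓ (t : ℝ) • x ≤ c • |y| := inf_le_left.trans (abs_smul_le hc.le y)
  have h2 : c⁻¹ • (|c • y| ⊓ (t : ℝ) • x) ≤ (c⁻¹ * t) • x := by
    rw [mul_smul]
    exact smul_le_smul_of_nonneg_left inf_le_right (inv_nonneg.2 hc.le)
  have h3 := le_bandSeminorm hf (mul_nonneg (inv_nonneg.2 hc.le) t.2)
    (inv_smul_le_of_le_smul' hc h1) h2
  rw [map_smul, smul_eq_mul, inv_mul_le_iff₀ hc] at h3
  exact h3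

theorem bandSeminorm_smul {f : StrongDual ℝ E} (hf : 0 ≤ f) {x : E} {c : ℝ}
    (hc : 0 < c) (y : E) : bandSeminorm f x (c • y) = c * bandSeminorm f x y := by
  refine le_antisymm (bandSeminorm_smul_le hf hc y) ?_
  have := bandSeminorm_smul_le hf (x := x) (inv_pos.2 hc) (c • y)
  rwa [inv_smul_smul₀ hc.ne', le_inv_mul_iff₀ hc] at this

theorem bandSeminorm_neg (f : StrongDual ℝ E) (x y : E) :
    bandSeminorm f x (-y) = bandSeminorm f x y := by
  simp only [bandSeminorm, abs_neg]

/-- At each level `t` the pieces `|y| ⊓ t • x i` are pairwise disjoint and below `|y|`, so their sum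
is too. They increase with `t`, so the finite sum passes to the limit. -/
theorem sum_bandSeminorm_le {f : StrongDual ℝ E} (hf : 0 ≤ f) {x : ℕ → E} (hx : ∀ n, 0 ≤ x n)
    (hdisj : DisjointSeq x) (s : Finset ℕ) (y : E) :
    ∑ i ∈ s, bandSeminorm f (x i) y ≤ f |y| := by
  have hlim : Tendsto (fun t : NNReal => ∑ i ∈ s, f (|y| ⊓ (t : ℝ) • x i)) atTop
      (𝓝 (∑ i ∈ s, bandSeminorm f (x i) y)) :=
    tendsto_finsetSum _ fun i _ => tendsto_atTop_ciSup
      (fun t t' htt' => dual_apply_le_apply hf (inf_le_inf_left _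
        (smul_le_smul_of_nonneg_right (by exact_mod_cast htt') (hx i))))
      (bandSeminorm_bddAbove hf _ _)
  refine le_of_tendsto' hlim fun t => ?_
  rw [← map_sum]
  have h0 : ∀ i, 0 ≤ |y| ⊓ (t : ℝ) • x i := fun i =>
    le_inf (abs_nonneg y) (smul_nonneg t.2 (hx i))
  refine dual_apply_le_apply hf (sum_le_of_pairwise_disjoint h0 (fun i j hij => ?_)
    (fun i => inf_le_left) (abs_nonneg y) s)
  refine le_antisymm ?_ (le_inf (h0 i) (h0 j))
  exact (inf_le_inf inf_le_right inf_le_right).trans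
    (smul_inf_smul_eq_zero (hx i) (hx j) (hdisj.inf_eq_zero hx hij) t.2 t.2).le

/-- Hahn–Banach, extending from the line through `y`. It turns the seminorms, whose sums are
bounded, into functionals that are weakly unconditionally summable. -/
theorem exists_dual_le_bandSeminorm {f : StrongDual ℝ E} (hf : 0 ≤ f) {x : E} (hx : 0 ≤ x)
    (y : E) : ∃ h : StrongDual ℝ E,
      h y = bandSeminorm f x y ∧ ∀ v, |h v| ≤ bandSeminorm f x v := by
  have hnn : ∀ v, 0 ≤ bandSeminorm f x v := fun v => by
    simpa using le_bandSeminorm hf (x := x) (y := v) (w := 0) le_rfl (abs_nonneg v) (by simp)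
  have hle : ∀ v, bandSeminorm f x v ≤ f |v| := fun v =>
    ciSup_le fun t => dual_apply_le_apply hf inf_le_left
  obtain ⟨h, hy, hb⟩ : ∃ h : E →ₗ[ℝ] ℝ,
      h y = bandSeminorm f x y ∧ ∀ v, h v ≤ bandSeminorm f x v := by
    by_cases hy0 : y = 0
    · refine ⟨0, ?_, fun v => hnn v⟩
      have := hle y
      rw [hy0, abs_zero, map_zero] at this
      simpa [hy0] using (le_antisymm this (hnn 0)).symm
    · obtain ⟨h, h1, h2⟩ := exists_extension_of_le_sublinear
        (LinearPMap.mkSpanSingleton y (bandSeminorm f x y) hy0) (bandSeminorm f x)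
        (fun c hc v => bandSeminorm_smul hf hc v) (bandSeminorm_add_le hf hx) (by
          rintro ⟨v, hv⟩
          obtain ⟨c, rfl⟩ := Submodule.mem_span_singleton.1 hv
          rw [LinearPMap.mkSpanSingleton'_apply, smul_eq_mul]
          rcases lt_trichotomy c 0 with hc | rfl | hc
          · exact (mul_nonpos_of_nonpos_of_nonneg hc.le (hnn y)).trans (hnn _)
          · simpa using hnn 0
          · exact (bandSeminorm_smul hf hc y).ge)
      refine ⟨h, ?_, h2⟩
      have := h1 ⟨y, Submodule.mem_span_singleton_self y⟩
      rwa [LinearPMap.mkSpanSingleton_apply] at this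
  have habs : ∀ v, |h v| ≤ bandSeminorm f x v := fun v => abs_le'.2 ⟨hb v, by
    rw [← map_neg, ← bandSeminorm_neg]
    exact hb (-v)⟩
  refine ⟨h.mkContinuous ‖f‖ fun v => (habs v).trans ((hle v).trans ?_), hy, habs⟩
  rw [← norm_abs_eq_norm v]
  exact (Real.le_norm_self _).trans (f.le_opNorm _)

/-- Positive disjoint sequences in the solid hull of a relatively weakly compact set are weakly
null. -/
theorem RelWeaklyCompact.weaklyNull_of_disjointSeq {W : Set E} (hW : RelWeaklyCompact W)
    {x : ℕ → E} (hx : ∀ n, 0 ≤ x n) (hdisj : DisjointSeq x)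
    (hxW : ∀ n, x n ∈ LatticeOrderedAddCommGroup.solidClosure W) : WeaklyNull x := by
  choose y hyW hy using hxW
  have hpos : ∀ f : StrongDual ℝ E, 0 ≤ f → Tendsto (fun n => f (x n)) atTop (𝓝 0) := by
    intro f hf
    -- Here `f (x n) ≤ h n (y n)`, because `x n ≤ |y n|` and level `t = 1` of the supremum captures
    -- `x n`.
    choose h h1 h2 using fun n => exists_dual_le_bandSeminorm hf (hx n) (y n)
    refine squeeze_zero (fun n => hf _ (hx n)) (fun n => ?_)
      (hW.tendsto_apply_zero (h := h) (C := ‖f‖) (fun s v => ?_) hyW)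
    · rw [h1]
      refine le_bandSeminorm hf zero_le_one ((le_abs_self _).trans (hy n)) (by rw [one_smul])
    · refine (Finset.sum_le_sum fun i _ => h2 i v).trans
        ((sum_bandSeminorm_le hf hx hdisj s v).trans ?_)
      rw [← norm_abs_eq_norm v]
      exact (Real.le_norm_self _).trans (f.le_opNorm _)
  refine weaklyNull_iff.2 fun f => squeeze_zero_norm (fun n => ?_) (hpos |f| (abs_nonneg f))
  have := abs_dual_apply_le f (x n)
  rwa [abs_of_nonneg (hx n)] at this

theorem RelWeaklyCompact.exists_norm_le_of_mem_solidClosure {W : Set E}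
    (hW : RelWeaklyCompact W) :
    ∃ C, ∀ w ∈ LatticeOrderedAddCommGroup.solidClosure W, ‖w‖ ≤ C := by
  obtain ⟨C, hC⟩ := hW.exists_norm_le
  exact ⟨C, fun v ⟨w, hw, hvw⟩ => (norm_le_norm_of_abs_le_abs hvw).trans (hC w hw)⟩

end SolidHull

/-! ### Extracting disjoint sequences against weak* null functionals. -/

section Disjointification

set_option linter.unusedSectionVars false

variable {E : Type*} [NormedAddCommGroup E] [NormedSpace ℝ E] [Lattice E] [HasSolidNorm E]
  [IsOrderedAddMonoid E]

/-- Each new index is taken so late that its functional nearly vanishes on the fixed vector built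
from all earlier `z j`. The power is indexed by `σ m`, so the recursion needs only the previous
index. -/
theorem exists_strictMono_dual_sum_le {g : ℕ → StrongDual ℝ E} (hg : WeakStarNull g)
    (z : ℕ → E) {ε : ℝ} (hε : 0 < ε) :
    ∃ σ : ℕ → ℕ, StrictMono σ ∧ ∀ m,
      g (σ (m + 1)) ((4 : ℝ) ^ (σ m + 1) • ∑ j ∈ Finset.range (σ m + 1), z j) ≤ ε := by
  have h : ∀ N, ∃ n, N < n ∧
      g n ((4 : ℝ) ^ (N + 1) • ∑ j ∈ Finset.range (N + 1), z j) ≤ ε := fun N =>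
    ((eventually_gt_atTop N).and
      (((weakStarNull_iff.1 hg _).eventually_lt_const hε).mono fun _ hn => hn.le)).exists
  choose F hF1 hF2 using h
  refine ⟨fun m => F^[m] 0, strictMono_nat_of_lt_succ fun m => ?_, fun m => ?_⟩
  · rw [Function.iterate_succ_apply']
    exact hF1 _
  · simp only [Function.iterate_succ_apply']
    exact hF2 _

variable [CompleteSpace E] [IsOrderedModule ℝ E]

theorem exists_pow_smul_le {z : ℕ → E} (hz : ∀ n, 0 ≤ z n) {C : ℝ} (hC : ∀ n, ‖z n‖ ≤ C) :
    ∃ Z : E, ∀ n, (2⁻¹ : ℝ) ^ n • z n ≤ Z := by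
  have hsum : Summable fun n => (2⁻¹ : ℝ) ^ n • z n := by
    refine Summable.of_norm_bounded
      ((summable_geometric_of_lt_one (r := (2⁻¹ : ℝ)) (by norm_num) (by norm_num)).mul_right C)
      fun n => ?_
    rw [norm_smul, norm_pow, Real.norm_of_nonneg (by norm_num : (0 : ℝ) ≤ 2⁻¹)]
    exact mul_le_mul_of_nonneg_left (hC n) (by positivity)
  exact ⟨_, fun n => hsum.le_tsum n fun m _ => smul_nonneg (by positivity) (hz m)⟩

/-- The vector subtracted from `z (σ m)` to make it disjoint from the others costs at most `ε / 4`
for `Y m` and, eventually, less than `ε / 4` for the multiple of `Z`. -/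
theorem exists_disjointSeq_le {g : ℕ → StrongDual ℝ E} (hg : WeakStarNull g)
    (hg0 : ∀ n, 0 ≤ g n) {z : ℕ → E} (hz : ∀ n, 0 ≤ z n) {C : ℝ} (hC : ∀ n, ‖z n‖ ≤ C)
    {ε : ℝ} (hε : 0 < ε) (hgz : ∀ n, ε ≤ g n (z n)) :
    ∃ (σ : ℕ → ℕ) (u : ℕ → E), StrictMono σ ∧ (∀ m, 0 ≤ u m) ∧ DisjointSeq u ∧
      (∀ m, u m ≤ z (σ m)) ∧ ∀ᶠ m in atTop, ε / 2 ≤ g (σ m) (u m) := by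
  obtain ⟨σ, hσ, hsmall⟩ := exists_strictMono_dual_sum_le hg z (show 0 < ε / 4 by positivity)
  obtain ⟨Z, hZ⟩ := exists_pow_smul_le (z := fun n => z (σ n)) (fun n => hz _) (fun n => hC _)
  have hZ0 : 0 ≤ Z := (hz (σ 0)).trans (by simpa using hZ 0)
  -- Nothing precedes index 0, so `Y 0 = 0`.
  let Y : ℕ → E := fun m => Nat.casesOn m 0
    fun m => (4 : ℝ) ^ (σ m + 1) • ∑ j ∈ Finset.range (σ m + 1), z j
  have hY0 : ∀ m, 0 ≤ Y m := fun m => by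
    cases m with
    | zero => exact le_rfl
    | succ m => exact smul_nonneg (by positivity) (Finset.sum_nonneg fun j _ => hz j)
  have hY : ∀ k m, k < m → (4 : ℝ) ^ m • z (σ k) ≤ Y m := fun k m hkm => by
    cases m with
    | zero => omega
    | succ m =>
      have hmem : σ k ∈ Finset.range (σ m + 1) :=
        Finset.mem_range.2 (Nat.lt_succ_of_le (hσ.monotone (Nat.le_of_lt_succ hkm)))
      have hpow : (4 : ℝ) ^ (m + 1) ≤ 4 ^ (σ m + 1) :=
        pow_le_pow_right₀ (by norm_num) (Nat.succ_le_succ (hσ.id_le m))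
      exact (smul_le_smul_of_nonneg_right hpow (hz _)).trans
        (smul_le_smul_of_nonneg_left
          (Finset.single_le_sum (f := z) (fun j _ => hz j) hmem) (by positivity))
  refine ⟨σ, fun m => (z (σ m) - Y m - (2⁻¹ : ℝ) ^ m • Z)⁺, hσ, fun m => posPart_nonneg _,
    disjointSeq_posPart_sub (fun n => hz _) hZ hY hY0, fun m => ?_, ?_⟩
  · simp only [posPart_def]
    exact sup_le ((sub_le_self _ (smul_nonneg (by positivity) hZ0)).trans
      (sub_le_self _ (hY0 m))) (hz _)
  · have hlim := ((weakStarNull_iff.1 hg Z).comp hσ.tendsto_atTop).eventually_lt_const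
      (show 0 < ε / 4 by positivity)
    filter_upwards [hlim, eventually_gt_atTop 0] with m hm hm0
    obtain ⟨m, rfl⟩ := Nat.exists_eq_succ_of_ne_zero hm0.ne'
    have h1 := dual_apply_le_apply (hg0 (σ (m + 1)))
      (le_posPart (z (σ (m + 1)) - Y (m + 1) - (2⁻¹ : ℝ) ^ (m + 1) • Z))
    rw [map_sub, map_sub, map_smul (g (σ (m + 1))) _ Z, smul_eq_mul] at h1
    have h2 := hgz (σ (m + 1))
    have h3 : g (σ (m + 1)) (Y (m + 1)) ≤ ε / 4 := hsmall m
    have h4 : 0 ≤ g (σ (m + 1)) Z := hg0 _ Z hZ0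
    have h5 : (2⁻¹ : ℝ) ^ (m + 1) * g (σ (m + 1)) Z ≤ g (σ (m + 1)) Z :=
      mul_le_of_le_one_left h4 (pow_le_one₀ (by norm_num) (by norm_num))
    have h6 : g (σ (m + 1)) Z < ε / 4 := hm
    have h7 : ε / 2 ≤ g (σ (m + 1)) (z (σ (m + 1))) - g (σ (m + 1)) (Y (m + 1)) -
        (2⁻¹ : ℝ) ^ (m + 1) * g (σ (m + 1)) Z := by linarith
    exact h7.trans h1

/-- If the moduli `|gₙ|` are weak* null but `gₙ` does not tend to zero uniformly on the solid hull
of a relatively weakly compact set, this is seen by a positive disjoint weakly null sequence. -/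
theorem exists_disjointSeq_not_tendsto {g : ℕ → StrongDual ℝ E}
    (hg : WeakStarNull fun n => |g n|) {W : Set E} (hW : RelWeaklyCompact W) {v : ℕ → E}
    (hv : ∀ n, v n ∈ LatticeOrderedAddCommGroup.solidClosure W) {ε : ℝ} (hε : 0 < ε)
    (hgv : ∀ n, ε ≤ |g n (v n)|) :
    ∃ (σ : ℕ → ℕ) (t : ℕ → E), StrictMono σ ∧ (∀ n, 0 ≤ t n) ∧ DisjointSeq t ∧
      WeaklyNull t ∧ ¬ Tendsto (fun n => g (σ n) (t n)) atTop (𝓝 0) := by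
  obtain ⟨C, hC⟩ := hW.exists_norm_le_of_mem_solidClosure
  obtain ⟨σ, u, hσ, hu0, hu, huv, hgu⟩ := exists_disjointSeq_le hg (fun n => abs_nonneg _)
    (z := fun n => |v n|) (fun n => abs_nonneg _)
    (fun n => (norm_abs_eq_norm (v n)).le.trans (hC _ (hv n))) hε
    (fun n => (hgv n).trans (abs_dual_apply_le _ _))
  choose t ht0 htu ht using fun m =>
    exists_lt_two_mul_sub (g (σ m)) (hu0 m) (show 0 < ε / 4 by positivity)
  have hsolid : ∀ w : ℕ → E, (∀ m, 0 ≤ w m) → (∀ m, w m ≤ u m) →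
      DisjointSeq w ∧ WeaklyNull w := fun w hw0 hwu => by
    have hd : DisjointSeq w := hu.mono fun m => by
      rw [abs_of_nonneg (hw0 m), abs_of_nonneg (hu0 m)]
      exact hwu m
    refine ⟨hd, hW.weaklyNull_of_disjointSeq hw0 hd fun m => ?_⟩
    refine LatticeOrderedAddCommGroup.isSolid_solidClosure W (hv (σ m)) ?_
    rw [abs_of_nonneg (hw0 m)]
    exact (hwu m).trans (huv m)
  -- Both `t` and `u` are admissible tests. If `g` tends to zero on both, then `2 * g t - g u` does
  -- too, although it eventually exceeds `ε / 2 - ε / 4`.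
  by_contra hcon
  push Not at hcon
  have h1 := hcon σ t hσ ht0 (hsolid t ht0 htu).1 (hsolid t ht0 htu).2
  have h2 := hcon σ u hσ hu0 hu (hsolid u hu0 fun m => le_rfl).2
  have h3 := (h1.const_mul 2).sub h2
  rw [mul_zero, sub_zero] at h3
  obtain ⟨m, hm1, hm2⟩ :=
    ((h3.eventually_lt_const (show 0 < ε / 4 by positivity)).and hgu).exists
  have := ht m
  linarith

end Disjointification

/-! ### Operators and almost limited sets. -/

section Operators

set_option linter.unusedSectionVars false

variable {E F : Type*}
  [NormedAddCommGroup E] [NormedSpace ℝ E] [Lattice E] [HasSolidNorm E] [IsOrderedAddMonoid E]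
  [NormedAddCommGroup F] [NormedSpace ℝ F] [Lattice F] [HasSolidNorm F] [IsOrderedAddMonoid F]

theorem WeakStarNull.of_abs_le {f g : ℕ → StrongDual ℝ F}
    (hg : WeakStarNull fun n => |g n|) (h : ∀ n, |f n| ≤ |g n|) : WeakStarNull f := by
  have hpos : ∀ x : F, 0 ≤ x → Tendsto (fun n => f n x) atTop (𝓝 0) := fun x hx => by
    refine squeeze_zero_norm (fun n => ?_) (weakStarNull_iff.1 hg x)
    have h1 := abs_dual_apply_le (f n) x
    rw [abs_of_nonneg hx] at h1
    exact h1.trans (h n x hx)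
  refine weakStarNull_iff.2 fun x => ?_
  have := (hpos _ (posPart_nonneg x)).sub (hpos _ (negPart_nonneg x))
  simp only [← map_sub, posPart_sub_negPart, sub_zero] at this
  exact this

theorem WeakStarNull.comp_clm {f : ℕ → StrongDual ℝ F} (hf : WeakStarNull f) (T : E →L[ℝ] F) :
    WeakStarNull fun n => (f n).comp T :=
  weakStarNull_iff.2 fun x => weakStarNull_iff.1 hf (T x)

theorem WeakStarNull.comp_strictMono {f : ℕ → StrongDual ℝ F} (hf : WeakStarNull f) {σ : ℕ → ℕ}
    (hσ : StrictMono σ) : WeakStarNull fun n => f (σ n) :=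
  weakStarNull_iff.2 fun x => (weakStarNull_iff.1 hf x).comp hσ.tendsto_atTop

theorem DualLatticeOpsSeqWeakStarContinuous.weakStarNull_abs
    (h : DualLatticeOpsSeqWeakStarContinuous E) {g : ℕ → StrongDual ℝ E} (hg : WeakStarNull g) :
    WeakStarNull fun n => |g n| := by
  have hneg : WeakStarNull fun n => -g n := weakStarNull_iff.2 fun x => by
    simpa using (weakStarNull_iff.1 hg x).neg
  have := (h g (fun n => -g n) 0 0 hg hneg).1
  rwa [sup_idem] at this

/-- If `T` maps `[-x, x]` into `[c, d]`, then `|f.comp T| x ≤ |f| (|c| + |d|)`, a bound at a vector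
independent of `f`. -/
theorem OrderBoundedOp.weakStarNull_abs_comp {T : E →L[ℝ] F} (hT : OrderBoundedOp T)
    {f : ℕ → StrongDual ℝ F} (hf : WeakStarNull fun n => |f n|) :
    WeakStarNull fun n => |(f n).comp T| := by
  have hpos : ∀ x : E, 0 ≤ x → Tendsto (fun n => |(f n).comp T| x) atTop (𝓝 0) := by
    intro x hx
    obtain ⟨c, d, hcd⟩ := hT (-x) x
    refine squeeze_zero (fun n => (abs_nonneg ((f n).comp T)) x hx) (fun n => ?_)
      (weakStarNull_iff.1 hf (|c| + |d|))
    refine dual_abs_apply_le _ hx fun y hy => ?_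
    have hTy := hcd ⟨y, ⟨neg_le.1 ((neg_le_abs y).trans hy), (le_abs_self y).trans hy⟩, rfl⟩
    have hle : |T y| ≤ |c| + |d| := abs_le'.2
      ⟨hTy.2.trans ((le_abs_self d).trans (le_add_of_nonneg_left (abs_nonneg c))),
        (neg_le_neg hTy.1).trans ((neg_le_abs c).trans (le_add_of_nonneg_right (abs_nonneg d)))⟩
    exact (le_abs_self _).trans ((abs_dual_apply_le (f n) (T y)).trans
      (dual_apply_le_apply (abs_nonneg _) hle))
  refine weakStarNull_iff.2 fun x => ?_
  have := (hpos _ (posPart_nonneg x)).sub (hpos _ (negPart_nonneg x))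
  simp only [← map_sub, posPart_sub_negPart, sub_zero] at this
  exact this

theorem WeakAlmostLimited.tendsto_apply {T : E →L[ℝ] F} (hT : WeakAlmostLimited T) {x : ℕ → E}
    (hx : WeaklyNull x) {f : ℕ → StrongDual ℝ F} (hfd : DisjointSeq f) (hf : WeakStarNull f) :
    Tendsto (fun n => f n (T (x n))) atTop (𝓝 0) := by
  refine Metric.tendsto_atTop.2 fun ε hε => ?_
  have h := Metric.tendstoUniformlyOn_iff.1
    ((hT _ (RelWeaklyCompact.range_of_weaklyNull hx)).2 f hfd hf) ε hε
  obtain ⟨N, hN⟩ := eventually_atTop.1 h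
  refine ⟨N, fun n hn => ?_⟩
  rw [dist_comm]
  exact hN n hn _ ⟨x n, ⟨n, rfl⟩, rfl⟩

theorem AlmostLimited.mono {A B : Set F} (hB : AlmostLimited B) (h : A ⊆ B) : AlmostLimited A :=
  ⟨hB.1.subset h, fun f hd hf => (hB.2 f hd hf).mono h⟩

theorem almostLimited_image_solidClosure [CompleteSpace E] [IsOrderedModule ℝ E]
    {T : E →L[ℝ] F}
    (habs : ∀ f : ℕ → StrongDual ℝ F, DisjointSeq f → WeakStarNull f →
      WeakStarNull fun n => |(f n).comp T|)
    (h : ∀ (x : ℕ → E) (f : ℕ → StrongDual ℝ F), (∀ n, 0 ≤ x n) → DisjointSeq x → WeaklyNull x →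
      DisjointSeq f → WeakStarNull f → Tendsto (fun n => f n (T (x n))) atTop (𝓝 0))
    {W : Set E} (hW : RelWeaklyCompact W) :
    AlmostLimited (T '' LatticeOrderedAddCommGroup.solidClosure W) := by
  constructor
  · obtain ⟨C, hC⟩ := hW.exists_norm_le_of_mem_solidClosure
    refine isBounded_iff_forall_norm_le.2 ⟨‖T‖ * C, ?_⟩
    rintro _ ⟨v, hv, rfl⟩
    exact (T.le_opNorm v).trans (mul_le_mul_of_nonneg_left (hC v hv) (norm_nonneg _))
  · intro f hfd hf
    by_contra hnot
    rw [Metric.tendstoUniformlyOn_iff] at hnot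
    push Not at hnot
    obtain ⟨ε, hε, hfreq⟩ := hnot
    obtain ⟨τ, hτ, hτv⟩ := extraction_of_frequently_atTop hfreq
    have hex : ∀ n, ∃ v ∈ LatticeOrderedAddCommGroup.solidClosure W,
        ε ≤ |(f (τ n)).comp T v| := fun n => by
      obtain ⟨_, ⟨v, hv, rfl⟩, hle⟩ := hτv n
      rw [dist_comm, Real.dist_eq, sub_zero] at hle
      exact ⟨v, hv, hle⟩
    choose v hv hle using hex
    have hd := hfd.comp hτ.injective
    have hn := hf.comp_strictMono hτ
    obtain ⟨σ, t, hσ, ht0, htd, ht, hcon⟩ :=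
      exists_disjointSeq_not_tendsto (habs _ hd hn) hW hv hε hle
    exact hcon (h t _ ht0 htd ht (hd.comp hσ.injective) (hn.comp_strictMono hσ))

end Operators

theorem mainTheorem4 {E F : Type*}
    [NormedAddCommGroup E] [NormedSpace ℝ E] [CompleteSpace E] [Lattice E] [HasSolidNorm E]
    [IsOrderedAddMonoid E] [IsOrderedModule ℝ E]
    [NormedAddCommGroup F] [NormedSpace ℝ F] [CompleteSpace F] [Lattice F] [HasSolidNorm F]
    [IsOrderedAddMonoid F] [IsOrderedModule ℝ F]
    (h : DualLatticeOpsSeqWeakStarContinuous E ∨ PropertyD F)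
    (T : E →L[ℝ] F) (hT : OrderBoundedOp T) :
    List.TFAE [
      WeakAlmostLimited T,
      ∀ (x : ℕ → E) (f : ℕ → StrongDual ℝ F), (∀ n, 0 ≤ x n) → WeaklyNull x →
        DisjointSeq f → WeakStarNull f → Tendsto (fun n => f n (T (x n))) atTop (𝓝 0),
      ∀ (x : ℕ → E) (f : ℕ → StrongDual ℝ F), DisjointSeq x → WeaklyNull x →
        DisjointSeq f → WeakStarNull f → Tendsto (fun n => f n (T (x n))) atTop (𝓝 0),
      ∀ (x : ℕ → E) (f : ℕ → StrongDual ℝ F), (∀ n, 0 ≤ x n) → DisjointSeq x → WeaklyNull x →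
        DisjointSeq f → WeakStarNull f → Tendsto (fun n => f n (T (x n))) atTop (𝓝 0),
      ∀ W : Set E, RelWeaklyCompact W →
        AlmostLimited (T '' LatticeOrderedAddCommGroup.solidClosure W)] ∧
    (PropertyD F →
      (WeakAlmostLimited T ↔
        ∀ (x : ℕ → E) (f : ℕ → StrongDual ℝ F), (∀ n, 0 ≤ x n) → WeaklyNull x →
          (∀ n, 0 ≤ f n) → DisjointSeq f → WeakStarNull f →
            Tendsto (fun n => f n (T (x n))) atTop (𝓝 0)) ∧
      (WeakAlmostLimited T ↔
        ∀ (x : ℕ → E) (f : ℕ → StrongDual ℝ F), (∀ n, 0 ≤ x n) → DisjointSeq x → WeaklyNull x →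
          (∀ n, 0 ≤ f n) → DisjointSeq f → WeakStarNull f →
            Tendsto (fun n => f n (T (x n))) atTop (𝓝 0))) := by
  have habs : ∀ f : ℕ → StrongDual ℝ F, DisjointSeq f → WeakStarNull f →
      WeakStarNull fun n => |(f n).comp T| := fun f hd hf => by
    rcases h with h | h
    · exact h.weakStarNull_abs (hf.comp_clm T)
    · exact hT.weakStarNull_abs_comp (h f hd hf)
  have h45 := fun h4 => fun W (hW : RelWeaklyCompact W) =>
    almostLimited_image_solidClosure (T := T) habs h4 hW
  have h51 : (∀ W : Set E, RelWeaklyCompact W →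
      AlmostLimited (T '' LatticeOrderedAddCommGroup.solidClosure W)) → WeakAlmostLimited T :=
    fun h5 W hW => (h5 W hW).mono (image_mono fun w hw => ⟨w, hw, le_rfl⟩)
  refine ⟨?_, fun hD => ?_⟩
  · tfae_have 1 → 2 := fun h1 x f _ hx hfd hf => h1.tendsto_apply hx hfd hf
    tfae_have 1 → 3 := fun h1 x f _ hx hfd hf => h1.tendsto_apply hx hfd hf
    tfae_have 2 → 4 := fun h2 x f hx0 _ hx hfd hf => h2 x f hx0 hx hfd hf
    tfae_have 3 → 4 := fun h3 x f _ hxd hx hfd hf => h3 x f hxd hx hfd hf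
    tfae_have 4 → 5 := h45
    tfae_have 5 → 1 := h51
    tfae_finish
  · have h71 : (∀ (x : ℕ → E) (f : ℕ → StrongDual ℝ F), (∀ n, 0 ≤ x n) → DisjointSeq x →
        WeaklyNull x → (∀ n, 0 ≤ f n) → DisjointSeq f → WeakStarNull f →
          Tendsto (fun n => f n (T (x n))) atTop (𝓝 0)) → WeakAlmostLimited T := by
      -- Split `f n` into positive and negative parts. Both are dominated by `|f n|`, so they
      -- inherit disjointness, and property (d) makes them weak* null.
      refine fun h7 => h51 (h45 fun x f hx0 hxd hx hfd hf => ?_)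
      have hp := h7 x (fun n => (f n)⁺) hx0 hxd hx (fun n => posPart_nonneg _)
        (hfd.mono fun n => abs_posPart_le _)
        ((hD f hfd hf).of_abs_le fun n => abs_posPart_le _)
      have hm := h7 x (fun n => (f n)⁻) hx0 hxd hx (fun n => negPart_nonneg _)
        (hfd.mono fun n => abs_negPart_le _)
        ((hD f hfd hf).of_abs_le fun n => abs_negPart_le _)
      have := hp.sub hm
      simp only [← sub_apply, posPart_sub_negPart, sub_zero] at this
      exact this
    exact ⟨⟨fun h1 x f _ hx _ hfd hf => h1.tendsto_apply hx hfd hf,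
        fun h6 => h71 fun x f hx0 _ hx hf0 hfd hf => h6 x f hx0 hx hf0 hfd hf⟩,
      fun h1 x f _ _ hx _ hfd hf => h1.tendsto_apply hx hfd hf, h71⟩
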